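/- Let $\mathbb K$ be an algebraically closed field of characteristic $0$ (for instance $\mathbb K=\mathbb C$). **Normal form.** For linear maps $A,B:U\to V$ of finite-dimensional vector spaces over $\mathbb K$, a Jordan–Kronecker normal form of the pencil $A+\lambda B$ is a choice of bases of $U$ and $V$ in which $A$ and $B$ are simultaneously block-diagonal, each pair of blocks $(A_i,B_i)$ being one of the following. Here $I_k$ is the identity matrix, $N_k$ is the nilpotent $k\times k$ matrix with ones on the first superdiagonal, and $k,h,v\ge 1$. * A $k\times k$ Jordan block with eigenvalue $\lambda_0\in\mathbb K$: $A_i=\lambda_0I_k+N_k$, $B_i=I_k$. * A $k\times k$ Jordan block with eigenvalue $\infty$: $A_i=I_k$, $B_i=N_k$. * A horizontal Kronecker block of index $h$: the $(h-1)\times h$ matrices $A_i=(0\mid I_{h-1})$, $B_i=(I_{h-1}\mid 0)$. * A vertical Kronecker block of index $v$: the $v\times(v-1)$ matrices $A_i=\begin{pmatrix}0\\ I_{v-1}\end{pmatrix}$, $B_i=\begin{pmatrix}I_{v-1}\\ 0\end{pmatrix}$. For $h=1$ this is an empty $0\times1$ block (a zero column), and for $v=1$ an empty $1\times 0$ block (a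 zero row). The algebraic type of the pencil consists of the multiset of indices of the horizontal blocks, the multiset of indices of the vertical blocks, the number of distinct eigenvalues of the Jordan blocks and, for each of these eigenvalues, the multiset of sizes of its Jordan blocks. **Invariants of a representation.** For a representation $\rho:\mathfrak g\to\mathfrak{gl}(V)$ of a finite-dimensional Lie algebra and $x\in V$ let $R_x:\mathfrak g\to V$, $R_x(\xi)=\rho(\xi)x$. The Jordan–Kronecker invariant of $\rho$ is the algebraic type of the pencil $R_a+\lambda R_b$ for a generic pair $(a,b)$, that is, for all $(a,b)$ in some nonempty Zariski open subset of $V\times V$. **Theorem.** Let $n\ge 2$ and let $\rho:\operatorname{n}(n)\to\operatorname{gl}(n)$ be the standard representation on $\mathbb K^n$ of the Lie algebra $\operatorname{n}(n)$ of strictly upper triangular $n\times n$ matrices. Then for a generic pair $(a,b)$ the pencil $R_a+\lambda R_b$ has a Jordan–Kronecker normal form, and each of its Jordan–Kronecker normal forms has exactly the following blocks, so that these are the Jordan–Kronecker invariants of $\rho$: * $\frac{(n-1)(n-2)}{2}$ horizontal indices, namely $\underbrace{1,\dots,1}_{(n-3)(n-2)/2},\ \underbrace{2,\dots,2}_{n-2}$;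 * one Jordan $1\times1$ block; * one vertical index, $v_1=1$. -/

import Mathlib

open Module

/-- The blocks that occur in the Jordan--Kronecker normal form of a pencil `A + lam B`. All sizes
are positive. The horizontal block of index `1` has size `0 × 1` and the vertical block of index `1`
has size `1 × 0`; several of these together make up a zero block. -/
inductive JKBlock (K : Type*) where
  /-- The `k × k` Jordan block with eigenvalue `μ` in the field. -/
  | jordan (μ : K) (k : ℕ+) : JKBlock K
  /-- The `k × k` Jordan block with eigenvalue infinity. -/
  | jordanInfty (k : ℕ+) : JKBlock K
  /-- The horizontal Kronecker block of width `h` and height `h - 1`. -/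
  | horizontal (h : ℕ+) : JKBlock K
  /-- The vertical Kronecker block of height `v` and width `v - 1`. -/
  | vertical (v : ℕ+) : JKBlock K

namespace JKBlock

variable {K : Type*}

/-- The number of rows of a block. -/
def height : JKBlock K → ℕ
  | jordan _ k => k
  | jordanInfty k => k
  | horizontal h => h - 1
  | vertical v => v

/-- The number of columns of a block. -/
def width : JKBlock K → ℕ
  | jordan _ k => k
  | jordanInfty k => k
  | horizontal h => h
  | vertical v => v - 1

/-- The constant coefficient `A` of the block `A + lam B`. -/
def matA [Field K] : (β : JKBlock K) → Matrix (Fin β.height) (Fin β.width) K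
  | jordan μ k => Matrix.of fun (i j : Fin (k : ℕ)) =>
      if (j : ℕ) = i then μ else if (j : ℕ) = i + 1 then 1 else 0
  | jordanInfty k => Matrix.of fun (i j : Fin (k : ℕ)) => if (j : ℕ) = i then 1 else 0
  | horizontal h => Matrix.of fun (i : Fin ((h : ℕ) - 1)) (j : Fin (h : ℕ)) =>
      if (j : ℕ) = i + 1 then 1 else 0
  | vertical v => Matrix.of fun (i : Fin (v : ℕ)) (j : Fin ((v : ℕ) - 1)) =>
      if (i : ℕ) = j + 1 then 1 else 0

/-- The coefficient `B` of the parameter in the block `A + lam B`. -/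
def matB [Field K] : (β : JKBlock K) → Matrix (Fin β.height) (Fin β.width) K
  | jordan _ k => Matrix.of fun (i j : Fin (k : ℕ)) => if (j : ℕ) = i then 1 else 0
  | jordanInfty k => Matrix.of fun (i j : Fin (k : ℕ)) => if (j : ℕ) = i + 1 then 1 else 0
  | horizontal h => Matrix.of fun (i : Fin ((h : ℕ) - 1)) (j : Fin (h : ℕ)) =>
      if (j : ℕ) = i then 1 else 0
  | vertical v => Matrix.of fun (i : Fin (v : ℕ)) (j : Fin ((v : ℕ) - 1)) =>
      if (i : ℕ) = j then 1 else 0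

/-- The eigenvalue of a Jordan block, in the projective line; Kronecker blocks have none. -/
def eigenvalue? : JKBlock K → Option (OnePoint K)
  | jordan μ _ => some (μ : OnePoint K)
  | jordanInfty _ => some OnePoint.infty
  | horizontal _ => none
  | vertical _ => none

/-- The size of a Jordan block. -/
def jordanSize? : JKBlock K → Option ℕ+
  | jordan _ k => some k
  | jordanInfty k => some k
  | horizontal _ => none
  | vertical _ => none

/-- The index of a horizontal Kronecker block. -/
def horizontal? : JKBlock K → Option ℕ+
  | horizontal h => some h
  | _ => none

/-- The index of a vertical Kronecker block. -/
def vertical? : JKBlock K → Option ℕ+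
  | vertical v => some v
  | _ => none

end JKBlock

/-- The discrete invariants of a pencil that form its algebraic type. -/
@[ext] structure AlgebraicType where
  /-- One entry for each distinct eigenvalue of the Jordan blocks, namely the multiset of the sizes
  of the Jordan blocks with this eigenvalue. -/
  jordan : Multiset (Multiset ℕ+)
  /-- The horizontal indices. -/
  horizontal : Multiset ℕ+
  /-- The vertical indices. -/
  vertical : Multiset ℕ+

open Classical in
/-- The algebraic type of a multiset of blocks. -/
noncomputable def AlgebraicType.ofBlocks {K : Type*} (S : Multiset (JKBlock K)) :
    AlgebraicType where
  jordan := (S.filterMap JKBlock.eigenvalue?).toFinset.val.map fun μ =>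
    (S.filter fun β => β.eigenvalue? = some μ).filterMap JKBlock.jordanSize?
  horizontal := S.filterMap JKBlock.horizontal?
  vertical := S.filterMap JKBlock.vertical?

section Pencil

variable {K U V : Type*} [Field K] [AddCommGroup U] [Module K U] [AddCommGroup V] [Module K V]

/-- A Jordan--Kronecker normal form of the pencil `A + lam B`: a finite family of blocks and bases
of `U` and `V` in which `A` and `B` are block-diagonal with these blocks. -/
structure JKForm (A B : U →ₗ[K] V) where
  /-- The index set of the blocks. -/
  ι : Type
  [fintype : Fintype ι]
  [decEq : DecidableEq ι]
  /-- The blocks. -/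
  block : ι → JKBlock K
  /-- The basis of the source, indexed by the columns of the blocks. -/
  basisU : Basis (Σ i, Fin (block i).width) K U
  /-- The basis of the target, indexed by the rows of the blocks. -/
  basisV : Basis (Σ i, Fin (block i).height) K V
  toMatrix_A : LinearMap.toMatrix basisU basisV A =
    Matrix.blockDiagonal' fun i => (block i).matA
  toMatrix_B : LinearMap.toMatrix basisU basisV B =
    Matrix.blockDiagonal' fun i => (block i).matB

/-- The multiset of blocks of a Jordan--Kronecker normal form. -/
def JKForm.blocks {A B : U →ₗ[K] V} (F : JKForm A B) : Multiset (JKBlock K) :=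
  letI := F.fintype
  Finset.univ.val.map F.block

/-- `τ` is the algebraic type of the pencil `A + lam B`: the pencil has a Jordan--Kronecker normal
form, and all its Jordan--Kronecker normal forms have the type `τ`. -/
def HasAlgebraicType (A B : U →ₗ[K] V) (τ : AlgebraicType) : Prop :=
  Nonempty (JKForm A B) ∧ ∀ F : JKForm A B, AlgebraicType.ofBlocks F.blocks = τ

/-- The property `Q` holds for a generic pair of vectors: it holds off the zero set of a nonzero
polynomial in the coordinates of the two vectors, that is, on a nonempty Zariski open subset of
`V × V`. -/
def ForGenericPair (K : Type*) {V : Type*} [Field K] [AddCommGroup V] [Module K V]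
    (Q : V → V → Prop) : Prop :=
  ∃ (d : ℕ) (e : Basis (Fin d) K V) (P : MvPolynomial (Fin d ⊕ Fin d) K), P ≠ 0 ∧
    ∀ a b : V, MvPolynomial.eval (Sum.elim (e.repr a) (e.repr b)) P ≠ 0 → Q a b

end Pencil

attribute [local instance] LieRing.ofAssociativeRing

section Representation

variable {K L V : Type*} [Field K] [LieRing L] [LieAlgebra K L] [AddCommGroup V] [Module K V]

/-- The operator `R_x : L → V`, `R_x ξ = ρ(ξ) x`. -/
def orbitOperator (ρ : L →ₗ⁅K⁆ Module.End K V) (x : V) : L →ₗ[K] V where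
  toFun ξ := ρ ξ x
  map_add' ξ η := by simp
  map_smul' c ξ := by simp

/-- `τ` is the Jordan--Kronecker invariant of the representation `ρ`: the algebraic type of the
pencil `R_a + lam R_b` for a generic pair `(a, b)`. -/
def IsJKInvariant (ρ : L →ₗ⁅K⁆ Module.End K V) (τ : AlgebraicType) : Prop :=
  ForGenericPair K fun a b : V => HasAlgebraicType (orbitOperator ρ a) (orbitOperator ρ b) τ

end Representation

/-- The Lie algebra `n(n)` of strictly upper triangular `n × n` matrices. -/
def strictUpperTriangular (K : Type*) [Field K] (n : ℕ) :
    LieSubalgebra K (Matrix (Fin n) (Fin n) K) where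
  carrier := {M | ∀ i j, j ≤ i → M i j = 0}
  zero_mem' := fun _ _ _ => rfl
  add_mem' := fun {M N} hM hN i j hij => by simp [hM i j hij, hN i j hij]
  smul_mem' := fun c M hM i j hij => by simp [hM i j hij]
  lie_mem' := by
    have key : ∀ M N : Matrix (Fin n) (Fin n) K, (∀ i j, j ≤ i → M i j = 0) →
        (∀ i j, j ≤ i → N i j = 0) → ∀ i j, j ≤ i → (M * N) i j = 0 := by
      intro M N hM hN i j hij
      rw [Matrix.mul_apply]
      refine Finset.sum_eq_zero fun k _ => ?_
      rcases le_total k i with h | h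
      · rw [hM i k h, zero_mul]
      · rw [hN k j (hij.trans h), mul_zero]
    intro M N hM hN i j hij
    rw [Ring.lie_def, Matrix.sub_apply, key M N hM hN i j hij, key N M hN hM i j hij, sub_zero]

/-- The standard representation of `n(n)` on column vectors, `ρ(M) x = M x`. -/
noncomputable def strictUpperTriangularStandardRep (K : Type*) [Field K] (n : ℕ) :
    strictUpperTriangular K n →ₗ⁅K⁆ Module.End K (Fin n → K) :=
  (lieEquivMatrix' (R := K) (n := Fin n)).symm.toLieHom.comp (strictUpperTriangular K n).incl

theorem strictUpperTriangularStandardRep_apply (K : Type*) [Field K] (n : ℕ)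
    (M : strictUpperTriangular K n) (x : Fin n → K) :
    strictUpperTriangularStandardRep K n M x = (M : Matrix (Fin n) (Fin n) K).mulVec x := by
  simp [strictUpperTriangularStandardRep]

-- Write m = n - 2. For a strictly upper triangular M and a row i ≤ m (counted from 1), the two
-- functionals (Mb)_i and (Ma)_i of M are independent as soon as D = a_{n-1} b_n - a_n b_{n-1} ≠ 0,
-- since the last two entries of the row are free. They are the two columns of a horizontal block of
-- index 2. Row n-1 has one free entry, so (Ma)_{n-1} = μ (Mb)_{n-1} with μ = a_n / b_n, a Jordan
-- block of size 1; row n vanishes identically, a vertical block of index 1. These 2m + 1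
-- functionals are jointly independent, and the pencil vanishes on their common kernel, of dimension
-- (m - 1)m/2, which gives the zero columns. This is `exists_form`, built on `exists_of_surjective`.
--
-- Every other normal form has the same blocks because dimensions attached to the pencil determine
-- them. The kernel of A + cB has dimension the number of horizontal blocks unless -c is an
-- eigenvalue; its jump at c = -μ detects a Jordan block; ker A ∩ ker B counts the horizontal blocks
-- of index 1; dim U - dim V then gives the number of vertical blocks. In `eq_standardBlocks` the
-- remaining blocks have at least one row each, and dim V = m + 2 leaves no room for more.

attribute [local instance] JKForm.fintype JKForm.decEq

/-! ### Kernel dimensions attached to a block. -/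

namespace JKBlock

variable {K : Type*} [Field K]

/-- The value `A + c B` of a block at the parameter `c`. -/
def matAt (c : K) (β : JKBlock K) : Matrix (Fin β.height) (Fin β.width) K :=
  β.matA + c • β.matB

/-- The dimension of the kernel of the block at the parameter `c`. -/
noncomputable def nullity (c : K) (β : JKBlock K) : ℕ :=
  finrank K (LinearMap.ker (β.matAt c).mulVecLin)

/-- The dimension of the common kernel of the two matrices of a block. -/
noncomputable def commonNullity (β : JKBlock K) : ℕ :=
  finrank K (LinearMap.ker β.matA.mulVecLin ⊓ LinearMap.ker β.matB.mulVecLin :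
    Submodule K (Fin β.width → K))

end JKBlock

/-! ### Kernel dimensions of a pencil as sums over the blocks of a normal form. -/

namespace JKForm

variable {K U V : Type*} [Field K] [AddCommGroup U] [Module K U] [AddCommGroup V] [Module K V]
  {A B : U →ₗ[K] V}

theorem sum_map_blocks (F : JKForm A B) (f : JKBlock K → ℕ) :
    (F.blocks.map f).sum = ∑ i, f (F.block i) := by
  rw [blocks, Multiset.map_map]
  rfl

theorem finrank_source (F : JKForm A B) : finrank K U = (F.blocks.map JKBlock.width).sum := by
  rw [sum_map_blocks, finrank_eq_card_basis F.basisU]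
  simp

theorem finrank_target (F : JKForm A B) : finrank K V = (F.blocks.map JKBlock.height).sum := by
  rw [sum_map_blocks, finrank_eq_card_basis F.basisV]
  simp

/-- The coordinates of a vector of the source in the columns of the `i`-th block. -/
noncomputable def component (F : JKForm A B) : U ≃ₗ[K] (∀ i, Fin (F.block i).width → K) :=
  F.basisU.equivFun ≪≫ₗ LinearEquiv.piCurry K (fun i (_ : Fin (F.block i).width) => K)

theorem component_apply (F : JKForm A B) (u : U) (i : F.ι) (j : Fin (F.block i).width) :
    F.component u i j = F.basisU.repr u ⟨i, j⟩ := rfl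

/-- A subspace that is described blockwise has the sum of the dimensions in the blocks. -/
theorem finrank_eq_sum_of_forall_component (F : JKForm A B) (W : Submodule K U)
    (N : ∀ β : JKBlock K, Submodule K (Fin β.width → K))
    (h : ∀ u, u ∈ W ↔ ∀ i, F.component u i ∈ N (F.block i)) :
    finrank K W = (F.blocks.map fun β => finrank K (N β)).sum := by
  rw [sum_map_blocks, ← finrank_pi_fintype K]
  refine LinearEquiv.finrank_eq
    { toFun := fun u i => ⟨F.component u i, (h u).1 u.2 i⟩
      map_add' := fun u v => by ext; simp
      map_smul' := fun c u => by ext; simp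
      invFun := fun x => ⟨F.component.symm fun i => x i, (h _).2 fun i => by simp⟩
      left_inv := fun u => by simp
      right_inv := fun x => by simp }

theorem apply_eq_zero_iff (F : JKForm A B) (f : U →ₗ[K] V)
    (M : ∀ i, Matrix (Fin (F.block i).height) (Fin (F.block i).width) K)
    (hM : LinearMap.toMatrix F.basisU F.basisV f = Matrix.blockDiagonal' M) (u : U) :
    f u = 0 ↔ ∀ i, (M i).mulVec (F.component u i) = 0 := by
  have key : ∀ i k, F.basisV.repr (f u) ⟨i, k⟩ = (M i).mulVec (F.component u i) k := by
    intro i k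
    rw [← LinearMap.toMatrix_mulVec_repr F.basisU F.basisV, hM, Matrix.mulVec, dotProduct,
      Fintype.sum_sigma, Finset.sum_eq_single i]
    · simp [Matrix.mulVec, dotProduct, component_apply]
    · intro j _ hj
      exact Finset.sum_eq_zero fun l _ => by
        rw [Matrix.blockDiagonal'_apply_ne _ _ _ hj.symm, zero_mul]
    · simp
  rw [← F.basisV.repr.map_eq_zero_iff, Finsupp.ext_iff, Sigma.forall]
  simp [key, funext_iff]

/-- The same bases block-diagonalize A + cB. The left side does not mention `F`, so the sum on the
right is the same for all normal forms of the pencil. -/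
theorem finrank_ker_add_smul (F : JKForm A B) (c : K) :
    finrank K (LinearMap.ker (A + c • B)) = (F.blocks.map (JKBlock.nullity c)).sum := by
  refine F.finrank_eq_sum_of_forall_component _
    (fun β => LinearMap.ker (β.matAt c).mulVecLin) fun u => ?_
  rw [LinearMap.mem_ker, F.apply_eq_zero_iff _ (fun i => (F.block i).matAt c)]
  · simp
  · rw [map_add, map_smul, F.toMatrix_A, F.toMatrix_B, ← Matrix.blockDiagonal'_smul,
      ← Matrix.blockDiagonal'_add]
    rfl

theorem finrank_ker_inf_ker (F : JKForm A B) :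
    finrank K (LinearMap.ker A ⊓ LinearMap.ker B : Submodule K U) =
      (F.blocks.map JKBlock.commonNullity).sum := by
  refine F.finrank_eq_sum_of_forall_component _
    (fun β => LinearMap.ker β.matA.mulVecLin ⊓ LinearMap.ker β.matB.mulVecLin) fun u => ?_
  rw [Submodule.mem_inf, LinearMap.mem_ker, LinearMap.mem_ker,
    F.apply_eq_zero_iff _ _ F.toMatrix_A, F.apply_eq_zero_iff _ _ F.toMatrix_B]
  simp [forall_and]

end JKForm

/-! ### Nullities of the individual blocks. -/

namespace JKBlock

variable {K : Type*} [Field K]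

theorem finrank_eq_zero_of_forall {W : Type*} [AddCommGroup W] [Module K W] {N : Submodule K W}
    (h : ∀ x ∈ N, x = 0) : finrank K N = 0 := by
  rw [(Submodule.eq_bot_iff N).2 h, finrank_bot]

theorem eq_zero_of_mulVec_of_upperTriangular {k : ℕ} {M : Matrix (Fin k) (Fin k) K}
    (hM : ∀ i j, j < i → M i j = 0) (hd : ∀ i, M i i ≠ 0) {x : Fin k → K}
    (hx : M.mulVec x = 0) : x = 0 := by
  refine Matrix.eq_zero_of_mulVec_eq_zero ?_ hx
  rw [Matrix.det_of_isUpperTriangular fun i j h => hM i j h]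
  exact Finset.prod_ne_zero_iff.2 fun i _ => hd i

theorem nullity_jordan_of_ne {c μ : K} (h : c ≠ -μ) (k : ℕ+) : (jordan μ k).nullity c = 0 := by
  refine finrank_eq_zero_of_forall fun x hx => ?_
  refine eq_zero_of_mulVec_of_upperTriangular ?_ ?_ (LinearMap.mem_ker.1 hx)
  · intro i j hij
    have h1 : (j : ℕ) < i := hij
    change (if (j : ℕ) = i then μ else if (j : ℕ) = i + 1 then 1 else 0) +
      c * (if (j : ℕ) = i then 1 else 0) = 0
    simp [h1.ne, show (j : ℕ) ≠ i + 1 by omega]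
  · intro i
    change (if (i : ℕ) = i then μ else if (i : ℕ) = i + 1 then 1 else 0) +
      c * (if (i : ℕ) = i then 1 else 0) ≠ 0
    simpa using fun h' => h (eq_neg_of_add_eq_zero_right h')

theorem nullity_jordan_one_pos (μ : K) : 0 < (jordan μ 1).nullity (-μ) := by
  have h0 : (jordan μ 1).matAt (-μ) = 0 := by
    ext (i : Fin 1) (j : Fin 1)
    obtain rfl : i = 0 := Subsingleton.elim _ _
    obtain rfl : j = 0 := Subsingleton.elim _ _
    change μ + -μ * 1 = 0
    ring
  rw [nullity, h0, Matrix.mulVecLin_zero, LinearMap.ker_zero, finrank_top, finrank_fin_fun]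
  exact Nat.one_pos

theorem nullity_jordanInfty (c : K) (k : ℕ+) : (jordanInfty k).nullity c = 0 := by
  refine finrank_eq_zero_of_forall fun x hx => ?_
  refine eq_zero_of_mulVec_of_upperTriangular ?_ ?_ (LinearMap.mem_ker.1 hx)
  · intro i j hij
    have h1 : (j : ℕ) < i := hij
    change (if (j : ℕ) = i then (1 : K) else 0) + c * (if (j : ℕ) = i + 1 then 1 else 0) = 0
    simp [h1.ne, show (j : ℕ) ≠ i + 1 by omega]
  · intro i
    change (if (i : ℕ) = i then (1 : K) else 0) + c * (if (i : ℕ) = i + 1 then 1 else 0) ≠ 0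
    simp

/-- Deleting the first row leaves a square upper triangular matrix with ones on the diagonal, for
every c. -/
theorem nullity_vertical (c : K) (v : ℕ+) : (vertical v).nullity c = 0 := by
  refine finrank_eq_zero_of_forall fun x hx => ?_
  have hv := v.pos
  refine eq_zero_of_mulVec_of_upperTriangular (k := (v : ℕ) - 1)
    (M := ((vertical v).matAt c).submatrix
      (fun j : Fin ((v : ℕ) - 1) => (⟨j + 1, by omega⟩ : Fin (v : ℕ))) id) ?_ ?_ ?_
  · intro i j hij
    have h1 : (j : ℕ) < i := hij
    change (if (i : ℕ) + 1 = j + 1 then (1 : K) else 0) +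
      c * (if (i : ℕ) + 1 = j then 1 else 0) = 0
    simp [h1.ne', show (i : ℕ) + 1 ≠ j by omega]
  · intro i
    change (if (i : ℕ) + 1 = i + 1 then (1 : K) else 0) +
      c * (if (i : ℕ) + 1 = i then 1 else 0) ≠ 0
    simp
  · ext (j : Fin ((v : ℕ) - 1))
    exact congrFun (LinearMap.mem_ker.1 hx) (⟨j + 1, by omega⟩ : Fin (v : ℕ))

theorem matA_horizontal_mulVec (h : ℕ+) (x : Fin (h : ℕ) → K) (i : ℕ) (hi : i + 1 < h) :
    (horizontal h).matA.mulVec x (⟨i, by omega⟩ : Fin ((h : ℕ) - 1)) = x ⟨i + 1, hi⟩ := by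
  change ∑ j : Fin (h : ℕ), (if (j : ℕ) = i + 1 then (1 : K) else 0) * x j = _
  rw [Finset.sum_eq_single ⟨i + 1, hi⟩]
  · simp
  · intro j _ hj
    rw [if_neg (fun h => hj (Fin.ext h)), zero_mul]
  · simp

theorem matB_horizontal_mulVec (h : ℕ+) (x : Fin (h : ℕ) → K) (i : ℕ) (hi : i + 1 < h) :
    (horizontal h).matB.mulVec x (⟨i, by omega⟩ : Fin ((h : ℕ) - 1)) = x ⟨i, by omega⟩ := by
  change ∑ j : Fin (h : ℕ), (if (j : ℕ) = i then (1 : K) else 0) * x j = _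
  rw [Finset.sum_eq_single ⟨i, by omega⟩]
  · simp
  · intro j _ hj
    rw [if_neg (fun h => hj (Fin.ext h)), zero_mul]
  · simp

theorem matAt_mulVec (c : K) (β : JKBlock K) (x : Fin β.width → K) :
    (β.matAt c).mulVec x = β.matA.mulVec x + c • β.matB.mulVec x := by
  rw [matAt, Matrix.add_mulVec, Matrix.smul_mulVec]

theorem matAt_horizontal_mulVec (c : K) (h : ℕ+) (x : Fin (h : ℕ) → K) (i : ℕ)
    (hi : i + 1 < h) :
    Matrix.mulVec ((horizontal h).matAt c) x (⟨i, by omega⟩ : Fin ((h : ℕ) - 1)) =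
      x ⟨i + 1, hi⟩ + c * x ⟨i, by omega⟩ :=
  (congrFun (matAt_mulVec c (horizontal h) x) _).trans (congrArg₂ (fun y z => y + c * z)
    (matA_horizontal_mulVec h x i hi) (matB_horizontal_mulVec h x i hi))

/-- The kernel equations are the recursion x_{i+1} = -c x_i, so the kernel is the line spanned by
the powers of -c. -/
theorem nullity_horizontal (c : K) (h : ℕ+) : (horizontal h).nullity c = 1 := by
  have hpos := h.pos
  have mem : ∀ x : Fin (h : ℕ) → K,
      x ∈ LinearMap.ker ((horizontal h).matAt c).mulVecLin ↔
      ∀ i (hi : i + 1 < (h : ℕ)), x ⟨i + 1, hi⟩ + c * x ⟨i, by omega⟩ = 0 := by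
    intro x
    constructor
    · intro hx i hi
      have hx' : Matrix.mulVec ((horizontal h).matAt c) x = 0 := hx
      rw [← matAt_horizontal_mulVec c h x i hi, hx']
      rfl
    · intro hx
      change Matrix.mulVec ((horizontal h).matAt c) x = 0
      ext (i : Fin ((h : ℕ) - 1))
      exact (matAt_horizontal_mulVec c h x i (by omega)).trans (hx i (by omega))
  refine finrank_eq_one (⟨fun i : Fin (h : ℕ) => (-c) ^ (i : ℕ), (mem _).2 fun i hi => ?_⟩ :
    LinearMap.ker ((horizontal h).matAt c).mulVecLin) ?_ ?_
  · simp only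
    ring
  · intro h0
    have := congrFun (congrArg Subtype.val h0) (⟨0, hpos⟩ : Fin (h : ℕ))
    exact one_ne_zero ((pow_zero (-c)).symm.trans this)
  · rintro ⟨x, hx⟩
    have hx' := (mem x).1 hx
    refine ⟨x (⟨0, hpos⟩ : Fin (h : ℕ)), Subtype.ext ?_⟩
    ext (i : Fin (h : ℕ))
    obtain ⟨i, hi⟩ := i
    change x (⟨0, hpos⟩ : Fin (h : ℕ)) * (-c) ^ i = x (⟨i, hi⟩ : Fin (h : ℕ))
    induction i with
    | zero => simp
    | succ i ih =>
      rw [eq_neg_of_add_eq_zero_left (hx' i hi), ← ih (by omega)]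
      ring

/-- The matrix B of the block is the identity; A would not do, being singular for μ = 0. -/
theorem commonNullity_jordan (μ : K) (k : ℕ+) : (jordan μ k).commonNullity = 0 := by
  refine finrank_eq_zero_of_forall fun x hx => ?_
  refine eq_zero_of_mulVec_of_upperTriangular ?_ ?_ (LinearMap.mem_ker.1 hx.2)
  · intro i j hij
    have h1 : (j : ℕ) < i := hij
    change (if (j : ℕ) = i then (1 : K) else 0) = 0
    simp [h1.ne]
  · intro i
    change (if (i : ℕ) = i then (1 : K) else 0) ≠ 0
    simp

theorem commonNullity_le_nullity_zero (β : JKBlock K) : β.commonNullity ≤ β.nullity 0 := by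
  refine Submodule.finrank_mono ?_
  rw [matAt, zero_smul, add_zero]
  exact inf_le_left

theorem commonNullity_horizontal_one : (horizontal 1 : JKBlock K).commonNullity = 1 := by
  have hA : (horizontal 1 : JKBlock K).matA = 0 := by
    ext (i : Fin 0)
    exact i.elim0
  have hB : (horizontal 1 : JKBlock K).matB = 0 := by
    ext (i : Fin 0)
    exact i.elim0
  rw [commonNullity, hA, hB, inf_idem, Matrix.mulVecLin_zero, LinearMap.ker_zero, finrank_top,
    finrank_fin_fun]
  rfl

/-- Bx lists all coordinates of x but the last, Ax all but the first; for h ≥ 2 together they see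
every coordinate. -/
theorem commonNullity_horizontal_of_ne_one {h : ℕ+} (hh : h ≠ 1) :
    (horizontal h : JKBlock K).commonNullity = 0 := by
  have hh' : 1 < (h : ℕ) := by
    have := h.pos
    have : (h : ℕ) ≠ 1 := fun e => hh (PNat.coe_eq_one_iff.1 e)
    omega
  refine finrank_eq_zero_of_forall fun x hx => ?_
  ext (i : Fin (h : ℕ))
  obtain ⟨i, hi⟩ := i
  by_cases hi' : i + 1 < h
  · rw [← matB_horizontal_mulVec h x i hi']
    exact congrFun (LinearMap.mem_ker.1 hx.2) _
  · obtain ⟨j, rfl⟩ : ∃ j, i = j + 1 := ⟨i - 1, by omega⟩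
    rw [← matA_horizontal_mulVec h x j hi]
    exact congrFun (LinearMap.mem_ker.1 hx.1) _

end JKBlock

/-! ### Counting blocks. -/

namespace JKBlock

variable {K : Type*}

/-- The indicator of the horizontal blocks. -/
def horizontalCount : JKBlock K → ℕ
  | horizontal _ => 1
  | _ => 0

/-- The indicator of the vertical blocks. -/
def verticalCount : JKBlock K → ℕ
  | vertical _ => 1
  | _ => 0

theorem width_add_verticalCount (β : JKBlock K) :
    β.width + β.verticalCount = β.height + β.horizontalCount := by
  cases β with
  | jordan μ k => rfl
  | jordanInfty k => rfl
  | horizontal h =>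
    have := h.pos
    simp only [width, verticalCount, height, horizontalCount]
    omega
  | vertical v =>
    have := v.pos
    simp only [width, verticalCount, height, horizontalCount]
    omega

theorem horizontalCount_le_one (β : JKBlock K) : β.horizontalCount ≤ 1 := by
  cases β <;> simp [horizontalCount]

theorem one_le_height {β : JKBlock K} (hβ : β ≠ horizontal 1) : 1 ≤ β.height := by
  cases β with
  | jordan μ k => exact k.pos
  | jordanInfty k => exact k.pos
  | vertical v => exact v.pos
  | horizontal h =>
    have h1 := h.pos
    have h2 : (h : ℕ) ≠ 1 := fun e => hβ (by rw [PNat.coe_eq_one_iff.1 e])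
    simp only [height]
    omega

theorem eq_horizontal_two {β : JKBlock K} (h1 : β.height = 1) (h2 : β.horizontalCount = 1) :
    β = horizontal 2 := by
  cases β with
  | horizontal h =>
    have h3 := h.pos
    simp only [height] at h1
    congr 1
    apply PNat.eq
    change (h : ℕ) = 2
    omega
  | _ => simp [horizontalCount] at h2

variable [Field K]

theorem commonNullity_eq_zero {β : JKBlock K} (hβ : β ≠ horizontal 1) : β.commonNullity = 0 := by
  cases β with
  | jordan μ k => exact commonNullity_jordan μ k
  | jordanInfty k =>
    exact Nat.le_zero.1 ((commonNullity_le_nullity_zero _).trans (nullity_jordanInfty 0 k).le)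
  | vertical v =>
    exact Nat.le_zero.1 ((commonNullity_le_nullity_zero _).trans (nullity_vertical 0 v).le)
  | horizontal h => exact commonNullity_horizontal_of_ne_one fun e => hβ (by rw [e])

theorem nullity_eq_horizontalCount {c : K} {β : JKBlock K} (h : ∀ μ k, β = jordan μ k → c ≠ -μ) :
    β.nullity c = β.horizontalCount := by
  cases β with
  | jordan μ k => exact nullity_jordan_of_ne (h μ k rfl) k
  | jordanInfty k => exact nullity_jordanInfty c k
  | vertical v => exact nullity_vertical c v
  | horizontal l => exact nullity_horizontal c l

/-- The blocks `p` times `0 × 1`, `m` times horizontal of index two, one Jordan block of size one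
and one vertical block of index one. -/
def standardBlocks (p m : ℕ) (μ : K) : Multiset (JKBlock K) :=
  jordan μ 1 ::ₘ vertical 1 ::ₘ
    (Multiset.replicate p (horizontal 1) + Multiset.replicate m (horizontal 2))

/-- The blocks `standardBlocks p m μ` are determined by a few numerical invariants. -/
theorem eq_standardBlocks {p m : ℕ} {μ : K} {k : ℕ+} {T : Multiset (JKBlock K)}
    (hJ : jordan μ k ∈ T) (hh : (T.map horizontalCount).sum = p + m)
    (hv : (T.map verticalCount).sum = 1) (hc : (T.map commonNullity).sum = p)
    (ht : (T.map height).sum = m + 2) : T = standardBlocks p m μ := by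
  classical
  obtain ⟨T, rfl⟩ := Multiset.exists_cons_of_mem hJ
  obtain ⟨v, hvT⟩ : ∃ v, vertical v ∈ T := by
    by_contra! hne
    have h0 : (T.map verticalCount).sum = 0 := by
      refine Multiset.sum_eq_zero fun x hx => ?_
      obtain ⟨β, hβ, rfl⟩ := Multiset.mem_map.1 hx
      cases β with
      | vertical v => exact absurd hβ (hne v)
      | _ => rfl
    rw [Multiset.map_cons, Multiset.sum_cons, h0] at hv
    exact absurd hv (by simp [verticalCount])
  obtain ⟨T, rfl⟩ := Multiset.exists_cons_of_mem hvT
  obtain ⟨q, R, rfl, hR⟩ : ∃ (q : ℕ) (R : Multiset (JKBlock K)),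
      T = Multiset.replicate q (horizontal 1) + R ∧ ∀ β ∈ R, β ≠ horizontal 1 := by
    refine ⟨T.count (horizontal 1), T.filter (· ≠ horizontal 1), ?_, fun β hβ =>
      (Multiset.mem_filter.1 hβ).2⟩
    rw [← Multiset.filter_eq', Multiset.filter_add_not]
  have hk := k.pos
  have hvpos := v.pos
  have hcR : (R.map commonNullity).sum = 0 := by
    refine Multiset.sum_eq_zero fun x hx => ?_
    obtain ⟨β, hβ, rfl⟩ := Multiset.mem_map.1 hx
    exact commonNullity_eq_zero (hR β hβ)
  have e1 : horizontalCount (jordan μ k) = 0 := rfl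
  have e2 : horizontalCount (vertical v : JKBlock K) = 0 := rfl
  have e3 : horizontalCount (horizontal 1 : JKBlock K) = 1 := rfl
  have e4 : height (jordan μ k) = k := rfl
  have e5 : height (vertical v : JKBlock K) = v := rfl
  have e6 : height (horizontal 1 : JKBlock K) = 0 := rfl
  have e7 : commonNullity (vertical v : JKBlock K) = 0 := commonNullity_eq_zero (by simp)
  simp only [Multiset.map_cons, Multiset.map_add, Multiset.map_replicate, Multiset.sum_cons,
    Multiset.sum_add, Multiset.sum_replicate, smul_eq_mul, e1, e2, e3, e4, e5, e6, e7, hcR,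
    commonNullity_horizontal_one, commonNullity_jordan] at hh hc ht
  -- Only the blocks of type `horizontal 1` have a common kernel, so their number is p, and `R`
  -- contains m horizontal blocks.
  obtain rfl : q = p := by omega
  have hle : ∀ S : Multiset (JKBlock K), (∀ β ∈ S, β ≠ horizontal 1) →
      (S.map horizontalCount).sum ≤ (S.map height).sum := fun S hS =>
    Multiset.sum_map_le_sum_map _ _ fun β hβ =>
      (horizontalCount_le_one β).trans (one_le_height (hS β hβ))
  -- This gives m ≤ height of `R`, while k + v + height of `R` equals m + 2 with k, v ≥ 1: all these
  -- inequalities are equalities.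
  have hRle := hle R hR
  have hk1 : k = 1 := PNat.coe_eq_one_iff.1 (by omega)
  have hv1 : v = 1 := PNat.coe_eq_one_iff.1 (by omega)
  have hR2 : ∀ β ∈ R, β = horizontal 2 := by
    intro β hβ
    have b1 := one_le_height (hR β hβ)
    have b2 := horizontalCount_le_one β
    obtain ⟨S, rfl⟩ := Multiset.exists_cons_of_mem hβ
    -- The totals over `R` agree, and `horizontalCount` is at most `height` on β and on the rest
    -- `S`; hence both are 1 on β.
    have b3 := hle S fun γ hγ => hR γ (Multiset.mem_cons_of_mem hγ)
    rw [Multiset.map_cons, Multiset.sum_cons] at hh ht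
    exact eq_horizontal_two (by omega) (by omega)
  have hRrep := Multiset.eq_replicate_card.2 hR2
  have hcard : Multiset.card R = m := by
    rw [hRrep, Multiset.map_replicate, Multiset.sum_replicate] at hh
    simp only [horizontalCount, smul_eq_mul] at hh
    omega
  rw [hRrep, hcard, hk1, hv1, standardBlocks]

/-- Some parameter is not an eigenvalue of any of finitely many blocks. -/
theorem exists_sum_nullity_eq [Infinite K] (S : Multiset (JKBlock K)) :
    ∃ c : K, ∀ β ∈ S, β.nullity c = β.horizontalCount := by
  classical
  let f : JKBlock K → K := fun β => match β with
    | jordan μ _ => -μ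
    -- A harmless default: it only excludes c = 0 as well.
    | _ => 0
  obtain ⟨c, hc⟩ := Infinite.exists_notMem_finset (S.map f).toFinset
  refine ⟨c, fun β hβ => nullity_eq_horizontalCount ?_⟩
  rintro μ k rfl rfl
  exact hc (Multiset.mem_toFinset.2 (Multiset.mem_map_of_mem f hβ))

end JKBlock

/-! ### Uniqueness of the blocks. -/

namespace JKForm

variable {K U V : Type*} [Field K] [AddCommGroup U] [Module K U] [AddCommGroup V] [Module K V]
  {A B : U →ₗ[K] V}

open JKBlock

theorem finrank_source_add (F : JKForm A B) :
    finrank K U + (F.blocks.map verticalCount).sum =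
      finrank K V + (F.blocks.map horizontalCount).sum := by
  rw [F.finrank_source, F.finrank_target, ← Multiset.sum_map_add, ← Multiset.sum_map_add]
  simp only [width_add_verticalCount]

theorem sum_horizontalCount_eq [Infinite K] (F G : JKForm A B) :
    (F.blocks.map horizontalCount).sum = (G.blocks.map horizontalCount).sum := by
  -- One parameter must be regular for both forms at once, so that both counts equal the dimension
  -- of the same kernel.
  obtain ⟨c, hc⟩ := exists_sum_nullity_eq (F.blocks + G.blocks)
  have key : ∀ S : Multiset (JKBlock K), S ≤ F.blocks + G.blocks →
      (S.map horizontalCount).sum = (S.map (nullity c)).sum := fun S hS => by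
    rw [Multiset.map_congr rfl fun β hβ => hc β (Multiset.mem_of_le hS hβ)]
  rw [key _ (Multiset.le_add_right _ _), key _ (Multiset.le_add_left _ _),
    ← finrank_ker_add_smul, ← finrank_ker_add_smul]

/-- A pencil with the blocks `standardBlocks p m μ` has no other blocks in any normal form. -/
theorem blocks_eq_standardBlocks [Infinite K] {p m : ℕ} {μ : K} (F G : JKForm A B)
    (hG : G.blocks = standardBlocks p m μ) : F.blocks = standardBlocks p m μ := by
  have s1 : (G.blocks.map horizontalCount).sum = p + m := by
    rw [hG]
    simp [standardBlocks, horizontalCount]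
  have s2 : (G.blocks.map verticalCount).sum = 1 := by
    rw [hG]
    simp [standardBlocks, verticalCount]
  have s3 : (G.blocks.map height).sum = m + 2 := by
    rw [hG]
    simp [standardBlocks, height]
    omega
  have s4 : (G.blocks.map commonNullity).sum = p := by
    rw [hG]
    simp [standardBlocks, commonNullity_horizontal_one, commonNullity_eq_zero]
  -- The kernel jumps at c = -μ. Transferred to `F`, the jump forces a Jordan block with eigenvalue
  -- μ, of a size still unknown.
  have s5 : p + m < (G.blocks.map (nullity (-μ))).sum := by
    have := nullity_jordan_one_pos μ
    rw [hG]
    simp only [standardBlocks, Multiset.map_cons, Multiset.map_add, Multiset.map_replicate,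
      Multiset.sum_cons, Multiset.sum_add, Multiset.sum_replicate, smul_eq_mul, nullity_horizontal]
    omega
  have hF := F.sum_horizontalCount_eq G
  rw [s1] at hF
  rw [← finrank_ker_add_smul, F.finrank_ker_add_smul] at s5
  obtain ⟨k, hk⟩ : ∃ k, jordan μ k ∈ F.blocks := by
    by_contra! hne
    have : (F.blocks.map (nullity (-μ))).sum = (F.blocks.map horizontalCount).sum := by
      refine congrArg _ (Multiset.map_congr rfl fun β hβ => nullity_eq_horizontalCount ?_)
      rintro ν k rfl h
      rw [neg_inj] at h
      exact hne k (h ▸ hβ)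
    omega
  refine eq_standardBlocks hk hF ?_ ?_ ?_
  · have h1 := F.finrank_source_add
    have h2 := G.finrank_source_add
    omega
  · rw [← F.finrank_ker_inf_ker, G.finrank_ker_inf_ker, s4]
  · rw [← F.finrank_target, G.finrank_target, s3]

end JKForm

/-! ### The algebraic type of the standard blocks. -/

theorem Multiset.filterMap_replicate_some {α β : Type*} {f : α → Option β} {a : α} {b : β}
    (h : f a = some b) (n : ℕ) :
    (Multiset.replicate n a).filterMap f = Multiset.replicate n b := by
  induction n with
  | zero => simp
  | succ n ih => rw [Multiset.replicate_succ, Multiset.filterMap_cons_some _ _ _ h, ih,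
      Multiset.replicate_succ]

theorem Multiset.filterMap_replicate_none {α β : Type*} {f : α → Option β} {a : α}
    (h : f a = none) (n : ℕ) : (Multiset.replicate n a).filterMap f = 0 := by
  induction n with
  | zero => simp
  | succ n ih => rw [Multiset.replicate_succ, Multiset.filterMap_cons_none _ _ h, ih]

theorem AlgebraicType.ofBlocks_standardBlocks {K : Type*} [Field K] (p m : ℕ) (μ : K) :
    AlgebraicType.ofBlocks (JKBlock.standardBlocks p m μ) =
      ⟨{{1}}, Multiset.replicate p 1 + Multiset.replicate m 2, {1}⟩ := by
  classical
  have hE : (JKBlock.standardBlocks p m μ).filterMap JKBlock.eigenvalue? = {(μ : OnePoint K)} := by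
    rw [JKBlock.standardBlocks, Multiset.filterMap_cons_some JKBlock.eigenvalue? _ _ rfl,
      Multiset.filterMap_cons_none _ _ rfl, Multiset.filterMap_add,
      Multiset.filterMap_replicate_none rfl, Multiset.filterMap_replicate_none rfl]
    rfl
  have hJ : (JKBlock.standardBlocks p m μ).filter
      (fun β => β.eigenvalue? = some (μ : OnePoint K)) = {JKBlock.jordan μ 1} := by
    rw [JKBlock.standardBlocks, Multiset.filter_cons_of_pos, Multiset.filter_cons_of_neg,
      Multiset.filter_add,
      Multiset.filter_eq_nil.2, Multiset.filter_eq_nil.2]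
    · rfl
    · intro β hβ
      simp [Multiset.eq_of_mem_replicate hβ, JKBlock.eigenvalue?]
    · intro β hβ
      simp [Multiset.eq_of_mem_replicate hβ, JKBlock.eigenvalue?]
    · simp [JKBlock.eigenvalue?]
    · rfl
  ext1
  · rw [ofBlocks]
    simp only [hE, Multiset.toFinset_singleton, Finset.singleton_val, Multiset.map_singleton]
    convert rfl
    rw [hJ]
    rfl
  · simp only [ofBlocks]
    rw [JKBlock.standardBlocks, Multiset.filterMap_cons_none _ _ rfl,
      Multiset.filterMap_cons_none _ _ rfl, Multiset.filterMap_add,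
      Multiset.filterMap_replicate_some (f := JKBlock.horizontal?) rfl,
      Multiset.filterMap_replicate_some (f := JKBlock.horizontal?) rfl]
  · simp only [ofBlocks]
    rw [JKBlock.standardBlocks, Multiset.filterMap_cons_none _ _ rfl,
      Multiset.filterMap_cons_some JKBlock.vertical? _ _ rfl, Multiset.filterMap_add,
      Multiset.filterMap_replicate_none rfl, Multiset.filterMap_replicate_none rfl]
    rfl

/-! ### Building a normal form from a surjection onto the columns. -/

namespace JKForm

variable {K U V : Type*} [Field K] [AddCommGroup U] [Module K U] [AddCommGroup V] [Module K V]
  {ι : Type}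

/-- The family of blocks `β` together with `p` zero columns. -/
def addZeroColumns (β : ι → JKBlock K) (p : ℕ) : ι ⊕ Fin p → JKBlock K :=
  Sum.elim β fun _ => JKBlock.horizontal 1

/-- The columns of `addZeroColumns β p`. -/
def columnEquiv (β : ι → JKBlock K) (p : ℕ) :
    (Σ i, Fin (β i).width) ⊕ Fin p ≃ Σ i, Fin (addZeroColumns β p i).width where
  toFun := Sum.elim (fun s => ⟨Sum.inl s.1, s.2⟩) fun j => ⟨Sum.inr j, (0 : Fin 1)⟩
  invFun
    | ⟨Sum.inl i, j⟩ => Sum.inl ⟨i, j⟩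
    | ⟨Sum.inr j, _⟩ => Sum.inr j
  left_inv := by rintro (s | j) <;> rfl
  right_inv := by
    rintro ⟨i | j, k⟩
    · rfl
    · exact congrArg (Sigma.mk (Sum.inr j)) (Subsingleton.elim (α := Fin 1) _ _)

/-- The rows of `addZeroColumns β p`. -/
def rowEquiv (β : ι → JKBlock K) (p : ℕ) :
    (Σ i, Fin (β i).height) ≃ Σ i, Fin (addZeroColumns β p i).height where
  toFun s := ⟨Sum.inl s.1, s.2⟩
  invFun
    | ⟨Sum.inl i, j⟩ => ⟨i, j⟩
    | ⟨Sum.inr _, k⟩ => Fin.elim0 (show Fin 0 from k)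
  left_inv := by rintro s; rfl
  right_inv := by
    rintro ⟨i | j, k⟩
    · rfl
    · exact Fin.elim0 (show Fin 0 from k)

variable [Fintype ι] [DecidableEq ι]

/-- By `hf`, `f` depends on u only through ψ u, so basis vectors killed by ψ give zero columns and
the others give the columns of the blocks. The family `M` is arbitrary so that both `matA` and
`matB` fit. -/
theorem toMatrix_eq_blockDiagonal' {β : ι → JKBlock K} {p : ℕ}
    (ψ : U →ₗ[K] ((Σ i, Fin (β i).width) → K)) (bV : Basis (Σ i, Fin (β i).height) K V)
    (bU : Basis ((Σ i, Fin (β i).width) ⊕ Fin p) K U)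
    (h1 : ∀ s, ψ (bU (Sum.inl s)) = Pi.single s 1) (h2 : ∀ j, ψ (bU (Sum.inr j)) = 0)
    (M : ∀ b : JKBlock K, Matrix (Fin b.height) (Fin b.width) K) (f : U →ₗ[K] V)
    (hf : ∀ u i k, bV.repr (f u) ⟨i, k⟩ = ∑ j, M (β i) k j * ψ u ⟨i, j⟩) :
    LinearMap.toMatrix (bU.reindex (columnEquiv β p)) (bV.reindex (rowEquiv β p)) f =
      Matrix.blockDiagonal' fun i => M (addZeroColumns β p i) := by
  ext r s
  obtain ⟨⟨i, k⟩, rfl⟩ := (rowEquiv β p).surjective r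
  obtain ⟨s, rfl⟩ := (columnEquiv β p).surjective s
  rw [LinearMap.toMatrix_apply, Basis.reindex_apply, Equiv.symm_apply_apply,
    Basis.repr_reindex_apply, Equiv.symm_apply_apply, hf]
  obtain ⟨j, l⟩ | j := s
  · rw [h1]
    by_cases hij : i = j
    · subst hij
      refine Eq.trans ?_ (Matrix.blockDiagonal'_apply_eq
        (fun i => M (addZeroColumns β p i)) (Sum.inl i) k l).symm
      rw [Finset.sum_eq_single l]
      · rw [Pi.single_eq_same, mul_one]
        rfl
      · intro l' _ hl
        rw [Pi.single_eq_of_ne, mul_zero]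
        simpa using hl
      · simp
    · refine Eq.trans ?_ (Matrix.blockDiagonal'_apply_ne
        (fun i => M (addZeroColumns β p i)) (k := Sum.inl i) (k' := Sum.inl j) k l
          (by simpa using hij)).symm
      refine Finset.sum_eq_zero fun l' _ => ?_
      rw [Pi.single_eq_of_ne, mul_zero]
      exact fun e => hij (congrArg Sigma.fst e)
  · rw [h2]
    refine Eq.trans ?_ (Matrix.blockDiagonal'_apply_ne
      (fun i => M (addZeroColumns β p i)) (k := Sum.inl i) (k' := Sum.inr j) k (0 : Fin 1)
        (by simp)).symm
    simp

/-- A pencil that factors through a surjection onto the source of a block-diagonal pencil has the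
same blocks, and a zero column for each dimension of the kernel of the surjection. -/
theorem exists_of_surjective [FiniteDimensional K U] {A B : U →ₗ[K] V} (β : ι → JKBlock K)
    (ψ : U →ₗ[K] ((Σ i, Fin (β i).width) → K)) (hψ : Function.Surjective ψ)
    (bV : Basis (Σ i, Fin (β i).height) K V)
    (hA : ∀ u i k, bV.repr (A u) ⟨i, k⟩ = ∑ j, (β i).matA k j * ψ u ⟨i, j⟩)
    (hB : ∀ u i k, bV.repr (B u) ⟨i, k⟩ = ∑ j, (β i).matB k j * ψ u ⟨i, j⟩) :
    ∃ F : JKForm A B, F.blocks = Finset.univ.val.map β +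
      Multiset.replicate (finrank K (LinearMap.ker ψ)) (JKBlock.horizontal 1) := by
  -- A linear section splits U into a copy of the target of ψ and the kernel of ψ, which yields a
  -- basis adapted to ψ.
  obtain ⟨σ, hσ⟩ := ψ.exists_rightInverse_of_surjective (LinearMap.range_eq_top.2 hψ)
  have hσ' : ∀ x, ψ (σ x) = x := fun x => LinearMap.congr_fun hσ x
  let e : (((Σ i, Fin (β i).width) → K) × LinearMap.ker ψ) ≃ₗ[K] U :=
    { toFun := fun x => σ x.1 + x.2
      map_add' := fun x y => by
        simp only [Prod.fst_add, Prod.snd_add, map_add, Submodule.coe_add]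
        abel
      map_smul' := fun c x => by simp
      invFun := fun u => (ψ u, ⟨u - σ (ψ u), by simp [hσ']⟩)
      left_inv := fun x => by
        have hx : ψ x.2 = 0 := x.2.2
        ext <;> simp [hσ', hx]
      right_inv := fun u => by simp }
  have he : ∀ x, ψ (e x) = x.1 := fun x => by
    have hx : ψ x.2 = 0 := x.2.2
    change ψ (σ x.1 + x.2) = x.1
    rw [map_add, hσ', hx, add_zero]
  let bU := ((Pi.basisFun K (Σ i, Fin (β i).width)).prod (finBasis K (LinearMap.ker ψ))).map e
  have h1 : ∀ s, ψ (bU (Sum.inl s)) = Pi.single s 1 := fun s => by simp [bU, he]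
  have h2 : ∀ j, ψ (bU (Sum.inr j)) = 0 := fun s => by simp [bU, he]
  refine ⟨⟨_, addZeroColumns β _, bU.reindex (columnEquiv β _), bV.reindex (rowEquiv β _),
    toMatrix_eq_blockDiagonal' ψ bV bU h1 h2 JKBlock.matA A hA,
    toMatrix_eq_blockDiagonal' ψ bV bU h1 h2 JKBlock.matB B hB⟩, ?_⟩
  simp only [blocks]
  rw [← Finset.univ_disjSum_univ, Finset.val_disjSum, Multiset.disjSum, Multiset.map_add,
    Multiset.map_map, Multiset.map_map]
  congr 1
  change Multiset.map (fun _ => JKBlock.horizontal 1) _ = _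
  simp

end JKForm

/-! ### The pencil of the standard representation. -/

namespace strictUpperTriangular

variable {K : Type*} {m : ℕ}

/-- The last but one index. -/
abbrev penultimate (m : ℕ) : Fin (m + 2) := (Fin.last m).castSucc

/-- The blocks of nonzero size of the pencil, one for each row. -/
def rowBlock (μ : K) : Fin m ⊕ Unit ⊕ Unit → JKBlock K
  | Sum.inl _ => JKBlock.horizontal 2
  | Sum.inr (Sum.inl _) => JKBlock.jordan μ 1
  | Sum.inr (Sum.inr _) => JKBlock.vertical 1

theorem height_rowBlock (μ : K) (i : Fin m ⊕ Unit ⊕ Unit) : (rowBlock μ i).height = 1 := by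
  rcases i with _ | _ | _ <;> rfl

/-- The row of a block. -/
def rowIndex : Fin m ⊕ Unit ⊕ Unit → Fin (m + 2)
  | Sum.inl i => i.castSucc.castSucc
  | Sum.inr (Sum.inl _) => penultimate m
  | Sum.inr (Sum.inr _) => Fin.last (m + 1)

theorem rowIndex_bijective : Function.Bijective (rowIndex (m := m)) := by
  constructor
  · rintro (i | _ | _) (j | _ | _) h <;>
      simp only [rowIndex, Fin.ext_iff, Fin.val_castSucc, Fin.val_last] at h
    · rw [Fin.ext h]
    all_goals first | rfl | omega
  · intro i
    induction i using Fin.lastCases with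
    | last => exact ⟨Sum.inr (Sum.inr ()), rfl⟩
    | cast i =>
      induction i using Fin.lastCases with
      | last => exact ⟨Sum.inr (Sum.inl ()), rfl⟩
      | cast i => exact ⟨Sum.inl i, rfl⟩

theorem sum_width_rowBlock (μ : K) :
    ∑ i : Fin m ⊕ Unit ⊕ Unit, (rowBlock μ i).width = 2 * m + 1 := by
  rw [Fintype.sum_sum_type, Fintype.sum_sum_type]
  change ∑ _ : Fin m, 2 + (∑ _ : Unit, 1 + ∑ _ : Unit, 0) = _
  simp [mul_comm]

theorem rowIndex_fst_bijective (μ : K) : Function.Bijective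
    fun s : Σ i : Fin m ⊕ Unit ⊕ Unit, Fin (rowBlock μ i).height => rowIndex s.1 := by
  refine rowIndex_bijective.comp ⟨?_, fun i => ⟨⟨i, ⟨0, by simp [height_rowBlock]⟩⟩, rfl⟩⟩
  rintro ⟨i, k⟩ ⟨j, l⟩ h
  obtain rfl : i = j := h
  have hk := k.2
  have hl := l.2
  have h1 := height_rowBlock μ i
  rw [Fin.ext (show (k : ℕ) = l by omega)]

variable [Field K]

/-- The coordinates on the strictly upper triangular matrices given by the entries above the
diagonal, listed by columns. -/
def coordinates (K : Type*) [Field K] (n : ℕ) :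
    strictUpperTriangular K n ≃ₗ[K] ((Σ j : Fin n, Fin (j : ℕ)) → K) where
  toFun M s := (M : Matrix (Fin n) (Fin n) K) (s.2.castLE s.1.2.le) s.1
  map_add' M N := by
    ext s
    simp
  map_smul' c M := by
    ext s
    simp
  invFun x := ⟨Matrix.of fun i j => if h : (i : ℕ) < j then x ⟨j, ⟨i, h⟩⟩ else 0, fun i j hij => by
    exact dif_neg (not_lt.2 hij)⟩
  left_inv M := by
    ext i j
    by_cases h : (i : ℕ) < j
    · exact dif_pos h
    · exact (dif_neg h).trans (M.2 i j (not_lt.1 h)).symm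
  right_inv x := by
    ext ⟨j, i⟩
    exact dif_pos i.2

instance (n : ℕ) : FiniteDimensional K (strictUpperTriangular K n) :=
  (coordinates K n).symm.finiteDimensional

theorem finrank_eq (K : Type*) [Field K] (n : ℕ) :
    finrank K (strictUpperTriangular K n) = n * (n - 1) / 2 := by
  rw [(coordinates K n).finrank_eq, finrank_fintype_fun_eq_card, Fintype.card_sigma]
  simp only [Fintype.card_fin]
  rw [Fin.sum_univ_eq_sum_range (fun i => i), Finset.sum_range_id]

/-- The matrix whose last two columns are `s` and `t` and whose other columns are zero. -/
def ofLastColumns (s t : Fin (m + 2) → K) (hs : ∀ i : Fin (m + 2), m ≤ (i : ℕ) → s i = 0)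
    (ht : t (Fin.last (m + 1)) = 0) : strictUpperTriangular K (m + 2) :=
  ⟨Matrix.of fun i j =>
    if j = Fin.last (m + 1) then t i else if j = penultimate m then s i else 0, by
    intro i j hij
    have hij' : (j : ℕ) ≤ i := hij
    simp only [Matrix.of_apply]
    split_ifs with h1 h2
    · subst h1
      rwa [Fin.last_le_iff.1 hij]
    · subst h2
      exact hs i (by simpa using hij')
    · rfl⟩

theorem ofLastColumns_mulVec (s t : Fin (m + 2) → K)
    (hs : ∀ i : Fin (m + 2), m ≤ (i : ℕ) → s i = 0) (ht : t (Fin.last (m + 1)) = 0)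
    (x : Fin (m + 2) → K) (i : Fin (m + 2)) :
    (ofLastColumns s t hs ht : Matrix (Fin (m + 2)) (Fin (m + 2)) K).mulVec x i =
      s i * x (penultimate m) + t i * x (Fin.last (m + 1)) := by
  rw [Matrix.mulVec, dotProduct, Fin.sum_univ_castSucc, Fin.sum_univ_castSucc]
  have h1 : ∀ j : Fin (m + 1), j.castSucc ≠ Fin.last (m + 1) := fun j => Fin.castSucc_ne_last j
  have h2 : ∀ j : Fin m, j.castSucc.castSucc ≠ penultimate m := fun j h =>
    Fin.castSucc_ne_last j (Fin.castSucc_injective _ h)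
  simp [ofLastColumns, h1, h2]

theorem mulVec_last (M : strictUpperTriangular K (m + 2)) (x : Fin (m + 2) → K) :
    (M : Matrix (Fin (m + 2)) (Fin (m + 2)) K).mulVec x (Fin.last (m + 1)) = 0 := by
  rw [Matrix.mulVec, dotProduct]
  exact Finset.sum_eq_zero fun j _ => by rw [M.2 _ j (Fin.le_last j), zero_mul]

theorem mulVec_penultimate (M : strictUpperTriangular K (m + 2)) (x : Fin (m + 2) → K) :
    (M : Matrix (Fin (m + 2)) (Fin (m + 2)) K).mulVec x (penultimate m) =
      (M : Matrix (Fin (m + 2)) (Fin (m + 2)) K) (penultimate m) (Fin.last (m + 1)) *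
        x (Fin.last (m + 1)) := by
  rw [Matrix.mulVec, dotProduct, Fin.sum_univ_castSucc, Finset.sum_eq_zero, zero_add]
  intro j _
  rw [M.2 _ _ (Fin.castSucc_le_castSucc_iff.2 (Fin.le_last j)), zero_mul]

/-- The standard basis of the target, indexed by the rows of the blocks. -/
noncomputable def rowBasis (μ : K) :
    Basis (Σ i : Fin m ⊕ Unit ⊕ Unit, Fin (rowBlock μ i).height) K (Fin (m + 2) → K) :=
  (Pi.basisFun K (Fin (m + 2))).reindex (Equiv.ofBijective _ (rowIndex_fst_bijective μ)).symm

theorem rowBasis_repr (μ : K) (v : Fin (m + 2) → K) (i : Fin m ⊕ Unit ⊕ Unit)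
    (k : Fin (rowBlock μ i).height) : (rowBasis μ).repr v ⟨i, k⟩ = v (rowIndex i) := by
  simp [rowBasis]

/-- The columns of the blocks as functionals of the two values of the pencil. -/
def columnMap {U : Type*} [AddCommGroup U] [Module K U] (A B : U →ₗ[K] (Fin (m + 2) → K))
    (μ : K) : U →ₗ[K] ((Σ i : Fin m ⊕ Unit ⊕ Unit, Fin (rowBlock μ i).width) → K) :=
  LinearMap.pi fun s =>
    -- The order matters: in the horizontal block of index 2, B = (1 | 0) reads column 0 and A = (0
    -- | 1) reads column 1. The Jordan block has B = 1, so its only column is also read by B.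
    (LinearMap.proj (rowIndex s.1)).comp (if (s.2 : ℕ) = 0 then B else A)

theorem columnMap_apply {U : Type*} [AddCommGroup U] [Module K U]
    (A B : U →ₗ[K] (Fin (m + 2) → K)) (μ : K) (u : U)
    (s : Σ i : Fin m ⊕ Unit ⊕ Unit, Fin (rowBlock μ i).width) :
    columnMap A B μ u s = if (s.2 : ℕ) = 0 then B u (rowIndex s.1) else A u (rowIndex s.1) := by
  simp only [columnMap, LinearMap.pi_apply, LinearMap.comp_apply, LinearMap.proj_apply]
  split_ifs <;> rfl

/-- The pencil of the standard representation at a generic pair of vectors has a normal form with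
the blocks `JKBlock.standardBlocks`. -/
theorem exists_form {a b : Fin (m + 2) → K} (hb : b (Fin.last (m + 1)) ≠ 0)
    (hab : a (penultimate m) * b (Fin.last (m + 1)) -
      a (Fin.last (m + 1)) * b (penultimate m) ≠ 0) :
    ∃ F : JKForm (orbitOperator (strictUpperTriangularStandardRep K (m + 2)) a)
        (orbitOperator (strictUpperTriangularStandardRep K (m + 2)) b),
      F.blocks = JKBlock.standardBlocks ((m - 1) * m / 2) m
        (a (Fin.last (m + 1)) / b (Fin.last (m + 1))) := by
  set A := orbitOperator (strictUpperTriangularStandardRep K (m + 2)) a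
  set B := orbitOperator (strictUpperTriangularStandardRep K (m + 2)) b
  set μ := a (Fin.last (m + 1)) / b (Fin.last (m + 1)) with hμ
  have hA : ∀ u, A u = (u : Matrix (Fin (m + 2)) (Fin (m + 2)) K).mulVec a := fun u =>
    strictUpperTriangularStandardRep_apply K (m + 2) u a
  have hB : ∀ u, B u = (u : Matrix (Fin (m + 2)) (Fin (m + 2)) K).mulVec b := fun u =>
    strictUpperTriangularStandardRep_apply K (m + 2) u b
  have hsurj : Function.Surjective (columnMap A B μ) := by
    intro y
    let D := a (penultimate m) * b (Fin.last (m + 1)) - a (Fin.last (m + 1)) * b (penultimate m)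
    let yA : Fin m → K := fun i => y ⟨Sum.inl i, (1 : Fin 2)⟩
    let yB : Fin m → K := fun i => y ⟨Sum.inl i, (0 : Fin 2)⟩
    let z : K := y ⟨Sum.inr (Sum.inl ()), (0 : Fin 1)⟩
    -- Cramer's rule, with determinant `D`, for s a_{n-1} + t a_n = yA and s b_{n-1} + t b_n = yB in
    -- each of the first m rows. In row n-1 only t is free, and t b_n = z fixes it.
    let s : Fin (m + 2) → K := Fin.snoc (α := fun _ => K) (Fin.snoc (α := fun _ => K) (fun i =>
      (yA i * b (Fin.last (m + 1)) - yB i * a (Fin.last (m + 1))) / D) 0) 0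
    let t : Fin (m + 2) → K := Fin.snoc (α := fun _ => K) (Fin.snoc (α := fun _ => K) (fun i =>
      (yB i * a (penultimate m) - yA i * b (penultimate m)) / D) (z / b (Fin.last (m + 1)))) 0
    have hs : ∀ i : Fin (m + 2), m ≤ (i : ℕ) → s i = 0 := by
      intro i hi
      induction i using Fin.lastCases with
      | last => simp [s]
      | cast i =>
        induction i using Fin.lastCases with
        | last => simp [s]
        | cast i => exact absurd i.2 (not_lt.2 hi)
    have ht : t (Fin.last (m + 1)) = 0 := by simp [t]
    refine ⟨ofLastColumns s t hs ht, ?_⟩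
    ext ⟨i, k⟩
    rw [columnMap_apply, hA, hB, ofLastColumns_mulVec, ofLastColumns_mulVec]
    obtain i | _ | _ := i
    · change Fin 2 at k
      have hs' : s (rowIndex (Sum.inl i)) =
          (yA i * b (Fin.last (m + 1)) - yB i * a (Fin.last (m + 1))) / D := by
        simp [s, rowIndex]
      have ht' : t (rowIndex (Sum.inl i)) =
          (yB i * a (penultimate m) - yA i * b (penultimate m)) / D := by
        simp [t, rowIndex]
      simp only [hs', ht']
      fin_cases k
      · change _ = yB i
        simp only [if_true]
        rw [div_mul_eq_mul_div, div_mul_eq_mul_div, ← add_div, div_eq_iff hab]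
        ring
      · change _ = yA i
        simp only [one_ne_zero, if_false]
        rw [div_mul_eq_mul_div, div_mul_eq_mul_div, ← add_div, div_eq_iff hab]
        ring
    · change Fin 1 at k
      obtain rfl : k = 0 := Subsingleton.elim _ _
      have hs' : s (rowIndex (Sum.inr (Sum.inl ()))) = 0 := by simp [s, rowIndex]
      have ht' : t (rowIndex (Sum.inr (Sum.inl ()))) = z / b (Fin.last (m + 1)) := by
        simp [t, rowIndex]
      simp only [hs', ht']
      change (if (0 : ℕ) = 0 then _ else _) = z
      rw [if_pos rfl, zero_mul, zero_add, div_mul_cancel₀ _ hb]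
    · exact Fin.elim0 (show Fin 0 from k)
  have hjordan : ∀ u, A u (penultimate m) = μ * B u (penultimate m) := fun u => by
    rw [hA, hB, mulVec_penultimate, mulVec_penultimate, hμ]
    field_simp
  have hlastA : ∀ u, A u (Fin.last (m + 1)) = 0 := fun u => by rw [hA, mulVec_last]
  have hlastB : ∀ u, B u (Fin.last (m + 1)) = 0 := fun u => by rw [hB, mulVec_last]
  obtain ⟨F, hF⟩ := JKForm.exists_of_surjective (A := A) (B := B) (rowBlock μ)
    (columnMap A B μ) hsurj (rowBasis μ) (by
      intro u i k
      rw [rowBasis_repr]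
      simp only [columnMap_apply]
      obtain i | _ | _ := i
      · change Fin 1 at k
        obtain rfl : k = 0 := Subsingleton.elim _ _
        refine Eq.trans ?_ (Fin.sum_univ_two (fun j : Fin 2 => _)).symm
        change A u _ = 0 * B u _ + 1 * A u _
        ring
      · change Fin 1 at k
        obtain rfl : k = 0 := Subsingleton.elim _ _
        refine Eq.trans ?_ (Fin.sum_univ_one (fun j : Fin 1 => _)).symm
        exact hjordan u
      · exact hlastA u) (by
      intro u i k
      rw [rowBasis_repr]
      simp only [columnMap_apply]
      obtain i | _ | _ := i
      · change Fin 1 at k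
        obtain rfl : k = 0 := Subsingleton.elim _ _
        refine Eq.trans ?_ (Fin.sum_univ_two (fun j : Fin 2 => _)).symm
        change B u _ = 1 * B u _ + 0 * A u _
        ring
      · change Fin 1 at k
        obtain rfl : k = 0 := Subsingleton.elim _ _
        refine Eq.trans ?_ (Fin.sum_univ_one (fun j : Fin 1 => _)).symm
        exact (one_mul _).symm
      · exact hlastB u)
  refine ⟨F, hF.trans ?_⟩
  have hker : finrank K (LinearMap.ker (columnMap A B μ)) = (m - 1) * m / 2 := by
    have h := (columnMap A B μ).finrank_range_add_finrank_ker
    rw [LinearMap.range_eq_top.2 hsurj, finrank_top, finrank_fintype_fun_eq_card, finrank_eq,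
      Fintype.card_sigma, Fintype.sum_congr _ _ fun i => Fintype.card_fin _,
      sum_width_rowBlock] at h
    -- Twice the identity dim U = (m - 1)m/2 + (2m + 1). The case m = 0 is separate because m - 1
    -- truncates there.
    have e : (m + 2) * (m + 2 - 1) = (m - 1) * m + (2 * m + 1) * 2 := by
      obtain _ | m := m
      · rfl
      · simp only [Nat.add_sub_cancel, show m + 1 + 2 - 1 = m + 2 by omega]
        ring
    rw [e, Nat.add_mul_div_right _ _ two_pos] at h
    omega
  rw [hker, ← Finset.univ_disjSum_univ, ← Finset.univ_disjSum_univ, Finset.val_disjSum,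
    Finset.val_disjSum]
  simp only [Multiset.disjSum, Multiset.map_add, Multiset.map_map, Function.comp_def, rowBlock,
    Multiset.map_const', JKBlock.standardBlocks]
  simp only [Finset.univ_unique, Finset.singleton_val, Multiset.card_singleton,
    Multiset.replicate_one, Finset.card_val, Finset.card_univ, Fintype.card_fin,
    ← Multiset.singleton_add]
  abel

/-- The polynomial whose nonvanishing makes a pair of vectors generic. -/
noncomputable def genericPolynomial (K : Type*) [Field K] (m : ℕ) :
    MvPolynomial (Fin (m + 2) ⊕ Fin (m + 2)) K :=
  MvPolynomial.X (Sum.inr (Fin.last (m + 1))) *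
    (MvPolynomial.X (Sum.inl (penultimate m)) * MvPolynomial.X (Sum.inr (Fin.last (m + 1))) -
      MvPolynomial.X (Sum.inl (Fin.last (m + 1))) * MvPolynomial.X (Sum.inr (penultimate m)))

theorem eval_genericPolynomial (a b : Fin (m + 2) → K) :
    MvPolynomial.eval (Sum.elim a b) (genericPolynomial K m) =
      b (Fin.last (m + 1)) * (a (penultimate m) * b (Fin.last (m + 1)) -
        a (Fin.last (m + 1)) * b (penultimate m)) := by
  simp [genericPolynomial]

theorem genericPolynomial_ne_zero : genericPolynomial K m ≠ 0 := by
  intro h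
  -- At a = e_{n-1}, b = e_n the polynomial takes the value 1.
  have h1 := eval_genericPolynomial (K := K) (m := m) (Pi.single (penultimate m) 1)
    (Pi.single (Fin.last (m + 1)) 1)
  rw [h, map_zero, Pi.single_eq_same, Pi.single_eq_same, Pi.single_eq_of_ne, zero_mul] at h1
  · simp at h1
  · exact (Fin.castSucc_ne_last _).symm

end strictUpperTriangular

/-! ### The Jordan–Kronecker invariants. -/

theorem isJKInvariant_strictUpperTriangularStandardRep (K : Type*) [Field K] [Infinite K] (m : ℕ) :
    IsJKInvariant (strictUpperTriangularStandardRep K (m + 2))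
      ⟨{{1}}, Multiset.replicate ((m - 1) * m / 2) 1 + Multiset.replicate m 2, {1}⟩ := by
  refine ⟨m + 2, Pi.basisFun K _, strictUpperTriangular.genericPolynomial K m,
    strictUpperTriangular.genericPolynomial_ne_zero, fun a b hab => ?_⟩
  have hab' := hab
  rw [show ((Pi.basisFun K (Fin (m + 2))).repr a : Fin (m + 2) → K) = a from rfl,
    show ((Pi.basisFun K (Fin (m + 2))).repr b : Fin (m + 2) → K) = b from rfl,
    strictUpperTriangular.eval_genericPolynomial] at hab'
  obtain ⟨G, hG⟩ := strictUpperTriangular.exists_form (left_ne_zero_of_mul hab')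
    (right_ne_zero_of_mul hab')
  refine ⟨⟨G⟩, fun F => ?_⟩
  rw [F.blocks_eq_standardBlocks G hG, AlgebraicType.ofBlocks_standardBlocks]

theorem theoremT (K : Type*) [Field K] [IsAlgClosed K] [CharZero K] (n : ℕ) (hn : 2 ≤ n) :
    ∃ τ : AlgebraicType,
      IsJKInvariant (strictUpperTriangularStandardRep K n) τ ∧
      Multiset.card τ.horizontal = (n - 1) * (n - 2) / 2 ∧
      τ.horizontal =
        Multiset.replicate ((n - 3) * (n - 2) / 2) 1 + Multiset.replicate (n - 2) 2 ∧
      τ.jordan = {{1}} ∧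
      τ.vertical = {1} := by
  obtain ⟨m, rfl⟩ : ∃ m, n = m + 2 := ⟨n - 2, by omega⟩
  refine ⟨_, isJKInvariant_strictUpperTriangularStandardRep K m, ?_, ?_, rfl, rfl⟩
  · simp only [Multiset.card_add, Multiset.card_replicate, Nat.add_sub_cancel,
      show m + 2 - 1 = m + 1 by omega]
    rw [← Nat.add_mul_div_right _ _ two_pos]
    congr 1
    -- The identity (m - 1)m + 2m = (m + 1)m needs the case m = 0 apart, where m - 1 truncates.
    obtain _ | m := m
    · rfl
    · simp only [Nat.add_sub_cancel]
      ring
  · rw [show m + 2 - 3 = m - 1 by omega, Nat.add_sub_cancel]
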